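/- Let $G=(V,E)$ be a finite connected simple graph (with at least one vertex) and let $\alpha\in(0,1]$. Define the third-order tensor $\mathcal A=(a_{ijk})_{i,j,k\in V}$ by $a_{ijk}=\alpha b_{ijk}+(1-\alpha)c_{ijk}$, where $b_{ijk}=1$ if $\{i,j\}\in E$ and $k=j$, and $b_{ijk}=0$ otherwise, while $c_{ijk}=\tfrac12$ if $i,j,k$ are the three vertices of a triangle of $G$, and $c_{ijk}=0$ otherwise (the $\alpha$-triangle tensor of $G$). For $x\in\mathbb C^V$ let $\mathcal A x^2\in\mathbb C^V$ have components $(\mathcal A x^2)_i=\sum_{j,k\in V}a_{ijk}x_jx_k$, and let $x^{[2]}=(x_i^2)_{i\in V}$. A number $\mu\in\mathbb C$ is an eigenvalue of $\mathcal A$, with eigenvector $x\in\mathbb C^V\setminus\{0\}$, if $\mathcal A x^2=\mu x^{[2]}$. Then the maximum modulus $\rho(\mathcal A)$ of the eigenvalues of $\mathcal A$ exists, and there is a vector $x\in\mathbb R^V$ with all $x_i>0$ such that $\mathcal A x^2=\rho(\mathcal A)\,x^{[2]}$. Moreover, this is the unique positive eigenvector of $\mathcal A$ up to scaling: if $y\in\mathbb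 R^V$ has all $y_i>0$ and $\mathcal A y^2=\mu\, y^{[2]}$ for some $\mu\in\mathbb C$, then $\mu=\rho(\mathcal A)$ and $y=c\,x$ for some real $c>0$. Thus the $\alpha$-triangle eigenvector centrality scores $x_i$ of the vertices of $G$ exist, are strictly positive, and are unique up to a common positive factor. -/

import Mathlib

namespace AlphaTEC

variable {V : Type*}

/-- Third-order complex tensors `(a i j k)` whose three indices range over `V`. -/
abbrev Tensor3 (V : Type*) : Type _ := V → V → V → ℂ

/-- The vector `A x²`, with `i`-th component `∑ j, ∑ k, a i j k * x j * x k`. -/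
def applySq [Fintype V] (A : Tensor3 V) (x : V → ℂ) : V → ℂ :=
  fun i => ∑ j, ∑ k, A i j k * x j * x k

/-- `x` is an eigenvector of `A` corresponding to `μ`: it is nonzero and `A x² = μ x^{[2]}`,
where `x^{[2]}` is the entrywise square of `x`. -/
def IsEigenvector [Fintype V] (A : Tensor3 V) (μ : ℂ) (x : V → ℂ) : Prop :=
  x ≠ 0 ∧ applySq A x = fun i => μ * x i ^ 2

/-- `μ` is an eigenvalue of the tensor `A`. -/
def IsEigenvalue [Fintype V] (A : Tensor3 V) (μ : ℂ) : Prop :=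
  ∃ x : V → ℂ, IsEigenvector A μ x

/-- The set of moduli of all (complex) eigenvalues of `A`. -/
def eigenvalueModuli [Fintype V] (A : Tensor3 V) : Set ℝ :=
  {r | ∃ μ : ℂ, IsEigenvalue A μ ∧ r = ‖μ‖}

/-- The spectral radius: the largest modulus of an eigenvalue. -/
noncomputable def tensorSpectralRadius [Fintype V] (A : Tensor3 V) : ℝ :=
  sSup (eigenvalueModuli A)

open Classical in
/-- The edge tensor: `b i j k = 1` if `{i, j}` is an edge and `k = j`, and `0` otherwise. -/
noncomputable def edgeTensor (G : SimpleGraph V) : Tensor3 V :=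
  fun i j k => if G.Adj i j ∧ k = j then 1 else 0

open Classical in
/-- The triangle tensor: `c i j k = 1/2` if `{i, j, k}` is (the vertex set of) a triangle of `G`,
and `0` otherwise. -/
noncomputable def triangleTensor (G : SimpleGraph V) : Tensor3 V :=
  fun i j k => if ({i, j, k} : Finset V) ∈ G.cliqueSet 3 then 1 / 2 else 0

/-- The `α`-triangle tensor `α A_E + (1 - α) A_△`. -/
noncomputable def alphaTriangleTensor (G : SimpleGraph V) (α : ℝ) : Tensor3 V :=
  (α : ℂ) • edgeTensor G + (1 - (α : ℂ)) • triangleTensor G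

end AlphaTEC

/-! Only two facts about the tensor matter: its entries are nonnegative, and `a i j j > 0` on every
edge of a connected graph. Let `r` be the largest `t ≥ 0` with `t x^{[2]} ≤ a x²` for some nonzero
`x ≥ 0`; compactness provides it. Were the inequality strict at one vertex, raising `x` slightly
there would make it strict at the neighbours, hence eventually everywhere, and `r` could grow. So
`x` is an eigenvector, and its positivity spreads along edges. By the triangle inequality the
entrywise moduli of a complex eigenvector for `μ` form a subeigenvector for `|μ|`, so `|μ| ≤ r`. For
uniqueness, scale `y` until it touches `x` from above; equality then spreads along edges. -/

namespace AlphaTEC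

section NonnegTensor

variable {V : Type*} [Fintype V]

/-- The vector `a x²` for a real third-order tensor `a` and a real vector `x`. -/
def realApplySq (a : V → V → V → ℝ) (x : V → ℝ) : V → ℝ :=
  fun i => ∑ j, ∑ k, a i j k * x j * x k

/-- `x` is nonnegative and nonzero, and `t x^{[2]} ≤ a x²` entrywise. -/
def IsSubeigenvector (a : V → V → V → ℝ) (t : ℝ) (x : V → ℝ) : Prop :=
  (∀ i, 0 ≤ x i) ∧ x ≠ 0 ∧ ∀ i, t * x i ^ 2 ≤ realApplySq a x i

lemma continuous_realApplySq_apply (a : V → V → V → ℝ) (i : V) :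
    Continuous fun x : V → ℝ => realApplySq a x i := by
  unfold realApplySq
  fun_prop

lemma realApplySq_smul (a : V → V → V → ℝ) (c : ℝ) (x : V → ℝ) (i : V) :
    realApplySq a (c • x) i = c ^ 2 * realApplySq a x i := by
  simp only [realApplySq, Finset.mul_sum, Pi.smul_apply, smul_eq_mul]
  refine Finset.sum_congr rfl fun j _ => Finset.sum_congr rfl fun k _ => ?_
  ring

/-- Each term of the difference is nonnegative, so the `(j, j)` term alone bounds it below. This
gain drives every propagation along an edge. -/
lemma realApplySq_add_le {a : V → V → V → ℝ} (ha : ∀ i j k, 0 ≤ a i j k) {x y : V → ℝ}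
    (hx : ∀ i, 0 ≤ x i) (hxy : ∀ i, x i ≤ y i) (i j : V) :
    realApplySq a x i + a i j j * (y j ^ 2 - x j ^ 2) ≤ realApplySq a y i := by
  have hterm : ∀ p q, 0 ≤ a i p q * (y p * y q - x p * x q) := fun p q =>
    mul_nonneg (ha i p q) (sub_nonneg.2
      (mul_le_mul (hxy p) (hxy q) (hx q) ((hx p).trans (hxy p))))
  have hdiff : realApplySq a y i - realApplySq a x i
      = ∑ p, ∑ q, a i p q * (y p * y q - x p * x q) := by
    simp only [realApplySq, ← Finset.sum_sub_distrib]
    refine Finset.sum_congr rfl fun p _ => Finset.sum_congr rfl fun q _ => ?_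
    ring
  have h1 : a i j j * (y j * y j - x j * x j) ≤ ∑ q, a i j q * (y j * y q - x j * x q) :=
    Finset.single_le_sum (f := fun q => a i j q * (y j * y q - x j * x q))
      (fun q _ => hterm j q) (Finset.mem_univ j)
  have h2 : ∑ q, a i j q * (y j * y q - x j * x q)
      ≤ ∑ p, ∑ q, a i p q * (y p * y q - x p * x q) :=
    Finset.single_le_sum (f := fun p => ∑ q, a i p q * (y p * y q - x p * x q))
      (fun p _ => Finset.sum_nonneg fun q _ => hterm p q) (Finset.mem_univ j)
  have h3 : a i j j * (y j ^ 2 - x j ^ 2) = a i j j * (y j * y j - x j * x j) := by ring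
  linarith

lemma realApplySq_mono {a : V → V → V → ℝ} (ha : ∀ i j k, 0 ≤ a i j k) {x y : V → ℝ}
    (hx : ∀ i, 0 ≤ x i) (hxy : ∀ i, x i ≤ y i) (i : V) :
    realApplySq a x i ≤ realApplySq a y i := by
  have h := realApplySq_add_le ha hx hxy i i
  have h2 : 0 ≤ a i i i * (y i ^ 2 - x i ^ 2) :=
    mul_nonneg (ha i i i) (sub_nonneg.2 (pow_le_pow_left₀ (hx i) (hxy i) 2))
  linarith

lemma mul_sq_le_realApplySq {a : V → V → V → ℝ} (ha : ∀ i j k, 0 ≤ a i j k) {x : V → ℝ}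
    (hx : ∀ i, 0 ≤ x i) (i j : V) : a i j j * x j ^ 2 ≤ realApplySq a x i := by
  have h := realApplySq_add_le ha (x := 0) (fun _ => le_rfl) hx i j
  simpa [realApplySq] using h

lemma realApplySq_nonneg {a : V → V → V → ℝ} (ha : ∀ i j k, 0 ≤ a i j k) {x : V → ℝ}
    (hx : ∀ i, 0 ≤ x i) (i : V) : 0 ≤ realApplySq a x i :=
  (mul_nonneg (ha i i i) (sq_nonneg _)).trans (mul_sq_le_realApplySq ha hx i i)

lemma IsSubeigenvector.smul {a : V → V → V → ℝ} {t : ℝ} {x : V → ℝ}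
    (h : IsSubeigenvector a t x) {c : ℝ} (hc : 0 < c) : IsSubeigenvector a t (c • x) := by
  refine ⟨fun i => mul_nonneg hc.le (h.1 i), smul_ne_zero hc.ne' h.2.1, fun i => ?_⟩
  rw [realApplySq_smul, Pi.smul_apply, smul_eq_mul, mul_pow, mul_left_comm]
  exact mul_le_mul_of_nonneg_left (h.2.2 i) (sq_nonneg c)

lemma IsSubeigenvector.sum_pos {a : V → V → V → ℝ} {t : ℝ} {x : V → ℝ}
    (h : IsSubeigenvector a t x) : 0 < ∑ i, x i := by
  obtain ⟨i, hi⟩ := Function.ne_iff.1 h.2.1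
  exact Finset.sum_pos' (fun i _ => h.1 i) ⟨i, Finset.mem_univ i, (h.1 i).lt_of_ne' hi⟩

/-- The inequality at a vertex where `x` is maximal bounds `t` by that row's sum. -/
lemma IsSubeigenvector.le_sum {a : V → V → V → ℝ} (ha : ∀ i j k, 0 ≤ a i j k) {t : ℝ}
    {x : V → ℝ} (h : IsSubeigenvector a t x) : t ≤ ∑ i, ∑ j, ∑ k, a i j k := by
  obtain ⟨i₀, hi₀⟩ := Function.ne_iff.1 h.2.1
  obtain ⟨m, -, hm⟩ := Finset.exists_max_image Finset.univ x ⟨i₀, Finset.mem_univ i₀⟩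
  have hmpos : 0 < x m := ((h.1 i₀).lt_of_ne' hi₀).trans_le (hm i₀ (Finset.mem_univ _))
  have h1 : realApplySq a x m ≤ (∑ j, ∑ k, a m j k) * x m ^ 2 := by
    simp only [realApplySq, Finset.sum_mul]
    refine Finset.sum_le_sum fun j _ => Finset.sum_le_sum fun k _ => ?_
    rw [mul_assoc, sq]
    exact mul_le_mul_of_nonneg_left
      (mul_le_mul (hm j (Finset.mem_univ _)) (hm k (Finset.mem_univ _)) (h.1 k) (h.1 m))
      (ha m j k)
  have h2 : t ≤ ∑ j, ∑ k, a m j k :=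
    le_of_mul_le_mul_right ((h.2.2 m).trans h1) (pow_pos hmpos 2)
  exact h2.trans (Finset.single_le_sum (f := fun i => ∑ j, ∑ k, a i j k)
    (fun i _ => Finset.sum_nonneg fun j _ => Finset.sum_nonneg fun k _ => ha i j k)
    (Finset.mem_univ m))

/-- The largest `t ≥ 0` admitting a subeigenvector exists (Collatz–Wielandt). -/
lemma exists_isGreatest_subeigenvalue [Nonempty V] {a : V → V → V → ℝ}
    (ha : ∀ i j k, 0 ≤ a i j k) :
    ∃ r, IsGreatest {t : ℝ | 0 ≤ t ∧ ∃ x, IsSubeigenvector a t x} r := by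
  classical
  set B := ∑ i, ∑ j, ∑ k, a i j k with hB
  -- Subeigenvectors can be rescaled, so the search may be confined to the simplex.
  let K : Set (ℝ × (V → ℝ)) :=
    (Set.Icc 0 B ×ˢ stdSimplex ℝ V) ∩ {p | ∀ i, p.1 * p.2 i ^ 2 ≤ realApplySq a p.2 i}
  have hK : IsCompact K := by
    refine (isCompact_Icc.prod (isCompact_stdSimplex ℝ V)).inter_right ?_
    simp only [Set.ofPred_forall]
    refine isClosed_iInter fun i => isClosed_le (by fun_prop) ?_
    exact (continuous_realApplySq_apply a i).comp continuous_snd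
  have hBnn : 0 ≤ B := Finset.sum_nonneg fun i _ => Finset.sum_nonneg fun j _ =>
    Finset.sum_nonneg fun k _ => ha i j k
  have hne : K.Nonempty := by
    obtain ⟨v⟩ := ‹Nonempty V›
    have hv := single_mem_stdSimplex ℝ v
    refine ⟨(0, Pi.single v 1), ⟨⟨le_rfl, hBnn⟩, hv⟩, fun i => ?_⟩
    simpa using realApplySq_nonneg ha hv.1 i
  obtain ⟨⟨r, x⟩, ⟨⟨hr, hx⟩, hrx⟩, hmax⟩ := hK.exists_isMaxOn hne continuous_fst.continuousOn
  refine ⟨r, ⟨hr.1, x, hx.1, ?_, hrx⟩, ?_⟩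
  · rintro rfl
    simpa using hx.2
  · rintro t ⟨ht, y, hy⟩
    have hs := hy.sum_pos
    have hy' := hy.smul (inv_pos.2 hs)
    have hmem : (t, (∑ i, y i)⁻¹ • y) ∈ K := by
      refine ⟨⟨⟨ht, hy.le_sum ha⟩, hy'.1, ?_⟩, hy'.2.2⟩
      simp only [Pi.smul_apply, smul_eq_mul, ← Finset.mul_sum]
      exact inv_mul_cancel₀ hs.ne'
    exact hmax hmem

/-- Along an edge, strictness of a subeigenvector inequality can be propagated. -/
lemma IsSubeigenvector.exists_strict_insert {a : V → V → V → ℝ} (ha : ∀ i j k, 0 ≤ a i j k)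
    {t : ℝ} {x : V → ℝ} (h : IsSubeigenvector a t x) {i j : V} (hij : 0 < a j i i)
    (hi : t * x i ^ 2 < realApplySq a x i) (hj : j ≠ i) :
    ∃ y, IsSubeigenvector a t y ∧ t * y j ^ 2 < realApplySq a y j ∧
      ∀ k, t * x k ^ 2 < realApplySq a x k → t * y k ^ 2 < realApplySq a y k := by
  classical
  -- By continuity, a slightly larger value at `i` keeps the inequality at `i` strict.
  have hc : Filter.Tendsto (fun s : ℝ => t * s ^ 2) (nhdsWithin (x i) (Set.Ioi (x i)))
      (nhds (t * x i ^ 2)) :=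
    ((by fun_prop : Continuous fun s : ℝ => t * s ^ 2).tendsto (x i)).mono_left
      nhdsWithin_le_nhds
  obtain ⟨s, hs, hxs⟩ := ((hc.eventually_lt_const hi).and self_mem_nhdsWithin).exists
  replace hxs : x i < s := hxs
  set y := Function.update x i s with hy
  have hyi : y i = s := Function.update_self ..
  have hyk : ∀ k, k ≠ i → y k = x k := fun k hk => Function.update_of_ne hk ..
  have hxy : ∀ k, x k ≤ y k := fun k => by
    by_cases hk : k = i
    · subst hk; rw [hyi]; exact hxs.le
    · rw [hyk k hk]
  have hmono := realApplySq_mono ha h.1 hxy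
  have hyi_lt : t * y i ^ 2 < realApplySq a y i := by
    rw [hyi]; exact hs.trans_le (hmono i)
  refine ⟨y, ⟨fun k => (h.1 k).trans (hxy k), fun h0 => ?_, fun k => ?_⟩, ?_, fun k hk => ?_⟩
  · have := (h.1 i).trans_lt hxs
    rw [← hyi, h0] at this
    exact lt_irrefl _ this
  · by_cases hk : k = i
    · subst hk; exact hyi_lt.le
    · rw [hyk k hk]; exact (h.2.2 k).trans (hmono k)
  · have h1 := realApplySq_add_le ha h.1 hxy j i
    have h2 : 0 < a j i i * (y i ^ 2 - x i ^ 2) :=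
      mul_pos hij (sub_pos.2 (by rw [hyi]; exact pow_lt_pow_left₀ hxs (h.1 i) two_ne_zero))
    rw [hyk j hj]
    linarith [h.2.2 j]
  · by_cases hki : k = i
    · subst hki; exact hyi_lt
    · rw [hyk k hki]; exact hk.trans_le (hmono k)

lemma forall_of_connected {W : Type*} {G : SimpleGraph W} (hG : G.Connected) {p : W → Prop}
    (hp : ∀ i j, G.Adj i j → p i → p j) {i : W} (hi : p i) (j : W) : p j := by
  obtain ⟨w⟩ := hG.preconnected i j
  induction w with
  | nil => exact hi
  | cons hadj _ ih => exact ih (hp _ _ hadj hi)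

/-- Induction on the number of non-strict vertices: while some remain, connectedness gives an edge
from a strict vertex to a non-strict one. -/
lemma IsSubeigenvector.exists_forall_strict {a : V → V → V → ℝ} {G : SimpleGraph V}
    (hG : G.Connected) (ha : ∀ i j k, 0 ≤ a i j k) (haG : ∀ i j, G.Adj i j → 0 < a i j j)
    {t : ℝ} {x : V → ℝ} (h : IsSubeigenvector a t x) {i : V}
    (hi : t * x i ^ 2 < realApplySq a x i) :
    ∃ y, IsSubeigenvector a t y ∧ ∀ j, t * y j ^ 2 < realApplySq a y j := by
  classical
  induction hn : (Finset.univ.filter fun j => ¬ t * x j ^ 2 < realApplySq a x j).card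
    using Nat.strong_induction_on generalizing x with
  | _ n ih =>
    by_cases hall : ∀ j, t * x j ^ 2 < realApplySq a x j
    · exact ⟨x, h, hall⟩
    · have hedge : ∃ p q, G.Adj p q ∧ t * x p ^ 2 < realApplySq a x p ∧
          ¬ t * x q ^ 2 < realApplySq a x q := by
        by_contra hcon
        push Not at hcon
        exact hall fun j => forall_of_connected hG
          (p := fun j => t * x j ^ 2 < realApplySq a x j)
          (fun p q hpq hp => hcon p q hpq hp) hi j
      obtain ⟨p, q, hpq, hp, hq⟩ := hedge
      obtain ⟨y, hy, hyq, hxy⟩ := h.exists_strict_insert ha (haG q p hpq.symm) hp hpq.ne'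
      refine ih _ ?_ hy (hxy i hi) rfl
      rw [← hn]
      refine Finset.card_lt_card (Finset.ssubset_iff_of_subset ?_ |>.2 ⟨q, ?_, ?_⟩)
      · intro k hk
        rw [Finset.mem_filter] at hk ⊢
        exact ⟨hk.1, fun hk' => hk.2 (hxy k hk')⟩
      · simpa using hq
      · simpa using hyq

lemma IsSubeigenvector.eq_of_isGreatest {a : V → V → V → ℝ} {G : SimpleGraph V}
    (hG : G.Connected) (ha : ∀ i j k, 0 ≤ a i j k) (haG : ∀ i j, G.Adj i j → 0 < a i j j)
    {r : ℝ} (hr : IsGreatest {t : ℝ | 0 ≤ t ∧ ∃ x, IsSubeigenvector a t x} r) {x : V → ℝ}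
    (h : IsSubeigenvector a r x) (i : V) : realApplySq a x i = r * x i ^ 2 := by
  by_contra hne
  obtain ⟨y, hy, hlt⟩ := h.exists_forall_strict hG ha haG ((h.2.2 i).lt_of_ne' hne)
  -- Finitely many strict inequalities survive a small increase of `r`.
  have hev : ∀ᶠ s in nhdsWithin r (Set.Ioi r), ∀ j, s * y j ^ 2 < realApplySq a y j := by
    refine Filter.eventually_all.2 fun j => ?_
    have hc : Filter.Tendsto (fun s : ℝ => s * y j ^ 2) (nhdsWithin r (Set.Ioi r))
        (nhds (r * y j ^ 2)) :=
      ((by fun_prop : Continuous fun s : ℝ => s * y j ^ 2).tendsto r).mono_left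
        nhdsWithin_le_nhds
    exact hc.eventually_lt_const (hlt j)
  obtain ⟨s, hs, hrs⟩ := (hev.and self_mem_nhdsWithin).exists
  replace hrs : r < s := hrs
  exact hrs.not_ge (hr.2 ⟨hr.1.1.trans hrs.le, y, hy.1, hy.2.1, fun j => (hs j).le⟩)

lemma pos_of_realApplySq_eq {a : V → V → V → ℝ} {G : SimpleGraph V}
    (hG : G.Connected) (ha : ∀ i j k, 0 ≤ a i j k) (haG : ∀ i j, G.Adj i j → 0 < a i j j)
    {r : ℝ} {x : V → ℝ} (hx : ∀ i, 0 ≤ x i) (hx0 : x ≠ 0)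
    (h : ∀ i, realApplySq a x i = r * x i ^ 2) (i : V) : 0 < x i := by
  obtain ⟨i₀, hi₀⟩ := Function.ne_iff.1 hx0
  refine forall_of_connected hG (p := fun i => 0 < x i) (fun p q hpq hp => ?_)
    ((hx i₀).lt_of_ne' hi₀) i
  refine (hx q).lt_of_ne' fun hq => ?_
  have h1 := mul_sq_le_realApplySq ha hx q p
  rw [h q, hq] at h1
  have h2 := mul_pos (haG q p hpq.symm) (pow_pos hp 2)
  linarith

lemma eq_smul_of_realApplySq_eq {a : V → V → V → ℝ} {G : SimpleGraph V}
    (hG : G.Connected) (ha : ∀ i j k, 0 ≤ a i j k) (haG : ∀ i j, G.Adj i j → 0 < a i j j)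
    {r m : ℝ} {x y : V → ℝ} (hx : ∀ i, 0 < x i) (hy : ∀ i, 0 < y i) (hmr : m ≤ r)
    (hxr : ∀ i, realApplySq a x i = r * x i ^ 2) (hym : ∀ i, realApplySq a y i = m * y i ^ 2) :
    m = r ∧ ∃ c : ℝ, 0 < c ∧ y = c • x := by
  obtain ⟨v⟩ := hG.nonempty
  obtain ⟨p, -, hp⟩ := Finset.exists_max_image Finset.univ (fun i => x i / y i)
    ⟨v, Finset.mem_univ v⟩
  -- The least scalar with `x ≤ c • y`; the two vectors touch at `p`.
  set c := x p / y p with hc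
  have hcpos : 0 < c := div_pos (hx p) (hy p)
  have hxy : ∀ i, x i ≤ (c • y) i := fun i => by
    have := hp i (Finset.mem_univ i)
    rwa [div_le_iff₀ (hy i)] at this
  have hp_eq : x p = (c • y) p := by
    simp only [hc, Pi.smul_apply, smul_eq_mul]
    exact (div_mul_cancel₀ _ (hy p).ne').symm
  have hcy : ∀ i, realApplySq a (c • y) i = m * (c • y) i ^ 2 := fun i => by
    rw [realApplySq_smul, hym, Pi.smul_apply, smul_eq_mul]; ring
  have hx0 : ∀ i, 0 ≤ x i := fun i => (hx i).le
  have hm : m = r := by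
    refine le_antisymm hmr ?_
    have h1 := realApplySq_mono ha hx0 hxy p
    rw [hxr, hcy, ← hp_eq] at h1
    exact le_of_mul_le_mul_right h1 (pow_pos (hx p) 2)
  have hall : ∀ i, x i = (c • y) i := forall_of_connected hG (fun i j hij hi => by
    have h1 := realApplySq_add_le ha hx0 hxy i j
    rw [hxr, hcy, ← hi, hm] at h1
    by_contra hne
    have h2 := mul_pos (haG i j hij) (sub_pos.2
      (pow_lt_pow_left₀ ((hxy j).lt_of_ne hne) (hx0 j) two_ne_zero))
    linarith) hp_eq
  refine ⟨hm, c⁻¹, inv_pos.2 hcpos, ?_⟩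
  rw [show x = c • y from funext hall, smul_smul, inv_mul_cancel₀ hcpos.ne', one_smul]

/-! ### Passage to complex eigenvalues -/

lemma applySq_ofReal (a : V → V → V → ℝ) (x : V → ℝ) (i : V) :
    applySq (fun i j k => (a i j k : ℂ)) (fun i => (x i : ℂ)) i = (realApplySq a x i : ℂ) := by
  simp [applySq, realApplySq]

lemma norm_applySq_ofReal_le {a : V → V → V → ℝ} (ha : ∀ i j k, 0 ≤ a i j k) (z : V → ℂ)
    (i : V) : ‖applySq (fun i j k => (a i j k : ℂ)) z i‖ ≤ realApplySq a (fun i => ‖z i‖) i := by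
  refine (norm_sum_le _ _).trans (Finset.sum_le_sum fun j _ =>
    (norm_sum_le _ _).trans (Finset.sum_le_sum fun k _ => ?_))
  rw [norm_mul, norm_mul, Complex.norm_real, Real.norm_of_nonneg (ha i j k)]

lemma IsEigenvector.isSubeigenvector_norm {a : V → V → V → ℝ} (ha : ∀ i j k, 0 ≤ a i j k)
    {μ : ℂ} {z : V → ℂ} (h : IsEigenvector (fun i j k => (a i j k : ℂ)) μ z) :
    IsSubeigenvector a ‖μ‖ fun i => ‖z i‖ := by
  refine ⟨fun i => norm_nonneg _, fun h0 => h.1 ?_, fun i => ?_⟩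
  · exact funext fun i => norm_eq_zero.1 (congrFun h0 i)
  · have h1 := norm_applySq_ofReal_le ha z i
    rwa [congrFun h.2 i, norm_mul, norm_pow] at h1

/-- Perron–Frobenius for nonnegative third-order tensors that are positive at `(i, j, j)` for
every edge `ij` of a connected graph. -/
theorem perronFrobenius {a : V → V → V → ℝ} {G : SimpleGraph V}
    (hG : G.Connected) (ha : ∀ i j k, 0 ≤ a i j k) (haG : ∀ i j, G.Adj i j → 0 < a i j j) :
    ∃ r : ℝ, IsGreatest (eigenvalueModuli fun i j k => (a i j k : ℂ)) r ∧
      ∃ x : V → ℝ, (∀ i, 0 < x i) ∧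
        IsEigenvector (fun i j k => (a i j k : ℂ)) (r : ℂ) (fun i => (x i : ℂ)) ∧
        ∀ (μ : ℂ) (y : V → ℝ), (∀ i, 0 < y i) →
          IsEigenvector (fun i j k => (a i j k : ℂ)) μ (fun i => (y i : ℂ)) →
          μ = (r : ℂ) ∧ ∃ c : ℝ, 0 < c ∧ y = c • x := by
  obtain ⟨v⟩ := hG.nonempty
  obtain ⟨r, hr⟩ := @exists_isGreatest_subeigenvalue V _ hG.nonempty a ha
  obtain ⟨hr0, x, hx⟩ := hr.1
  have hxr := hx.eq_of_isGreatest hG ha haG hr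
  have hxpos := pos_of_realApplySq_eq hG ha haG hx.1 hx.2.1 hxr
  have hle : ∀ μ, IsEigenvalue (fun i j k => (a i j k : ℂ)) μ → ‖μ‖ ≤ r := fun μ ⟨z, hz⟩ =>
    hr.2 ⟨norm_nonneg _, _, hz.isSubeigenvector_norm ha⟩
  have heig : IsEigenvector (fun i j k => (a i j k : ℂ)) (r : ℂ) (fun i => (x i : ℂ)) := by
    refine ⟨fun h0 => (hxpos v).ne' (Complex.ofReal_eq_zero.1 (congrFun h0 v)),
      funext fun i => ?_⟩
    rw [applySq_ofReal, hxr]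
    push_cast
    rfl
  refine ⟨r, ⟨⟨r, ⟨_, heig⟩, ?_⟩, ?_⟩, x, hxpos, heig, fun μ y hy hμ => ?_⟩
  · rw [Complex.norm_real, Real.norm_of_nonneg hr0]
  · rintro _ ⟨μ, hμ, rfl⟩
    exact hle μ hμ
  · have hμy : ∀ i, (realApplySq a y i : ℂ) = μ * (y i : ℂ) ^ 2 := fun i => by
      rw [← applySq_ofReal]; exact congrFun hμ.2 i
    -- A positive eigenvector forces a real eigenvalue: solve the equation at `v` for `μ`.
    obtain ⟨m, rfl⟩ : ∃ m : ℝ, μ = (m : ℂ) := by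
      refine ⟨realApplySq a y v / y v ^ 2, ?_⟩
      have hyv : (y v : ℂ) ≠ 0 := Complex.ofReal_ne_zero.2 (hy v).ne'
      push_cast
      rw [hμy v, mul_div_cancel_right₀ _ (pow_ne_zero 2 hyv)]
    have hmr : m ≤ r := by
      have := hle _ ⟨_, hμ⟩
      rw [Complex.norm_real] at this
      exact (Real.le_norm_self m).trans this
    obtain ⟨rfl, hc⟩ := eq_smul_of_realApplySq_eq hG ha haG hxpos hy hmr hxr
      fun i => by exact_mod_cast hμy i
    exact ⟨rfl, hc⟩

end NonnegTensor

/-- `α > 0` makes the edge entries positive; `α ≤ 1` keeps the triangle part nonnegative. -/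
lemma alphaTriangleTensor_eq_ofReal {V : Type*} (G : SimpleGraph V) {α : ℝ} (hα₀ : 0 < α)
    (hα₁ : α ≤ 1) :
    ∃ a : V → V → V → ℝ, (∀ i j k, 0 ≤ a i j k) ∧ (∀ i j, G.Adj i j → 0 < a i j j) ∧
      alphaTriangleTensor G α = fun i j k => (a i j k : ℂ) := by
  classical
  have hα : 0 ≤ 1 - α := sub_nonneg.2 hα₁
  refine ⟨fun i j k => α * (if G.Adj i j ∧ k = j then 1 else 0) +
    (1 - α) * (if ({i, j, k} : Finset V) ∈ G.cliqueSet 3 then 1 / 2 else 0),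
    fun i j k => ?_, fun i j hij => ?_, ?_⟩
  · positivity
  · dsimp only
    rw [if_pos ⟨hij, rfl⟩, mul_one]
    positivity
  · funext i j k
    simp only [alphaTriangleTensor, edgeTensor, triangleTensor, Pi.add_apply, Pi.smul_apply,
      smul_eq_mul]
    push_cast
    congr 2 <;> split_ifs <;> simp

end AlphaTEC

theorem mainTheorem2 {V : Type*} [Fintype V] (G : SimpleGraph V) (hG : G.Connected)
    (α : ℝ) (hα₀ : 0 < α) (hα₁ : α ≤ 1) :
    IsGreatest (AlphaTEC.eigenvalueModuli (AlphaTEC.alphaTriangleTensor G α))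
      (AlphaTEC.tensorSpectralRadius (AlphaTEC.alphaTriangleTensor G α)) ∧
    ∃ x : V → ℝ, (∀ i, 0 < x i) ∧
      AlphaTEC.IsEigenvector (AlphaTEC.alphaTriangleTensor G α)
        (AlphaTEC.tensorSpectralRadius (AlphaTEC.alphaTriangleTensor G α) : ℂ)
        (fun i => (x i : ℂ)) ∧
      ∀ (μ : ℂ) (y : V → ℝ), (∀ i, 0 < y i) →
        AlphaTEC.IsEigenvector (AlphaTEC.alphaTriangleTensor G α) μ (fun i => (y i : ℂ)) →
        μ = (AlphaTEC.tensorSpectralRadius (AlphaTEC.alphaTriangleTensor G α) : ℂ) ∧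
          ∃ c : ℝ, 0 < c ∧ y = c • x := by
  obtain ⟨a, ha, haG, hA⟩ := AlphaTEC.alphaTriangleTensor_eq_ofReal G hα₀ hα₁
  obtain ⟨r, hr, hx⟩ := AlphaTEC.perronFrobenius hG ha haG
  have hρ : AlphaTEC.tensorSpectralRadius (AlphaTEC.alphaTriangleTensor G α) = r := by
    rw [hA]; exact hr.csSup_eq
  rw [hρ, hA]
  exact ⟨hr, hx⟩
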